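/- Let $1<\beta<2$, $K,L,T>0$, let $\omega:[1,2]\to[0,\infty)$, and let $M,N,J\ge 1$ be integers. Put $h=L/M$, $\tau=T/N$, $x_i=ih$, $\Delta\alpha=\frac1{2J}$, $\alpha_l=1+l\Delta\alpha$, $\gamma_l=\alpha_l-1$ $(0\le l\le 2J)$, $c_0=c_{2J}=\frac12$ and $c_l=1$ for $1\le l\le 2J-1$. For $\gamma\in[0,1]$ let $g^{(\gamma)}_0=1$, $g^{(\gamma)}_k=\bigl(1-\frac{\gamma+1}{k}\bigr)g^{(\gamma)}_{k-1}$ $(k\ge1)$, and $\lambda^{(\gamma)}_0=(1+\frac\gamma2)g^{(\gamma)}_0$, $\lambda^{(\gamma)}_k=(1+\frac\gamma2)g^{(\gamma)}_k-\frac\gamma2 g^{(\gamma)}_{k-1}$ $(k\ge1)$. For $k\in\mathbb Z$ let $\hat g^{(\beta)}_k=\dfrac{(-1)^k\Gamma(\beta+1)}{\Gamma(\beta/2-k+1)\Gamma(\beta/2+k+1)}$. Let $$c_*^{(\beta)}=\frac2\beta\,e^{-2}\,\frac{(4-\beta)(2-\beta)\beta}{(6+\beta)(4+\beta)(2+\beta)}\cdot\frac{\Gamma(\beta+1)}{\Gamma(\frac\beta2+1)^2}\Bigl(3+\frac\beta2\Bigr)^{\beta+1}>0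 .$$ For a grid function write $w_i^{n-1/2}=\frac12(w_i^n+w_i^{n-1})$, $\delta_t w_i^{n-1/2}=\frac1\tau(w_i^n-w_i^{n-1})$. For $v=(v_0,\dots,v_M)$ with $v_0=v_M=0$ put $\hat v(\xi)=\frac{h}{\sqrt{2\pi}}\sum_{j=0}^{M}v_je^{-\mathrm i\xi x_j}$ and $|v|^2_{H^{\beta/2}}=\int_{-\pi/h}^{\pi/h}|\xi|^{\beta}|\hat v(\xi)|^2\,d\xi$, and for $v=(v_i)_{1\le i\le M-1}$ put $\|v\|^2=h\sum_{i=1}^{M-1}v_i^2$. **Theorem 3.2.** The following scheme is stable without any restriction on $h$, $\tau$, $\Delta\alpha$, in this sense. Let real numbers $u_i^n$ $(0\le i\le M,\ 0\le n\le N)$ satisfy $$\Delta\alpha\sum_{l=0}^{2J}c_l\,\omega(\alpha_l)\frac1{\tau^{\gamma_l}}\sum_{k=0}^{n-1}\lambda_k^{(\gamma_l)}\,\delta_tu_i^{n-k-\frac12}=-Kh^{-\beta}\sum_{k=i-M}^{i}\hat g_k^{(\beta)}u_{i-k}^{n-\frac12}+G_i^n,\qquad 1\le i\le M-1,\ 1\le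 n\le N,$$ with $u_i^0=\varphi_i$ $(1\le i\le M-1)$ and $u_0^n=u_M^n=0$ $(0\le n\le N)$, where $G_i^n,\varphi_i$ are arbitrary real numbers. Then for every $1\le m\le N$ $$\|u^m\|^2\le e^{T}\Bigl[\frac{3L^\beta}{c_*^{(\beta)}}|u^0|^2_{H^{\beta/2}}+\Bigl(\frac{2L^\beta}{Kc_*^{(\beta)}}\Bigr)^2\Bigl(\|G^1\|^2+\max_{1\le n\le m}\|G^n\|^2\Bigr)+\Bigl(\frac{2L^\beta}{Kc_*^{(\beta)}}\Bigr)^2\tau\sum_{n=1}^{m-1}\|\delta_tG^{n+\frac12}\|^2\Bigr].$$ -/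

import Mathlib

open scoped Real

noncomputable section

namespace FracWave

/-! Space grid `x_i = i h`, `0 ≤ i ≤ M`, `h = L / M`; time grid `t_n = n τ`, `0 ≤ n ≤ N`,
`τ = T / N`.  A grid function is `u : ℕ → ℕ → ℝ`, where `u n i` stands for `u_i^n`; only the
values with `i ≤ M` and `n ≤ N` are ever used. -/

/-- Grünwald coefficients `g_k^{(γ)}`: `g_0 = 1`, `g_k = (1 - (γ + 1) / k) g_{k-1}`. -/
def gCoef (γ : ℝ) : ℕ → ℝ
  | 0 => 1
  | k + 1 => (1 - (γ + 1) / ((k : ℝ) + 1)) * gCoef γ k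

/-- Weighted and shifted Grünwald coefficients:
`λ_0 = (1 + γ/2) g_0` and `λ_k = (1 + γ/2) g_k - (γ/2) g_{k-1}` for `k ≥ 1`. -/
def lamCoef (γ : ℝ) : ℕ → ℝ
  | 0 => (1 + γ / 2) * gCoef γ 0
  | k + 1 => (1 + γ / 2) * gCoef γ (k + 1) - γ / 2 * gCoef γ k

/-- Fractional centered difference coefficients
`ĝ_k^{(β)} = (-1)^k Γ(β+1) / (Γ(β/2 - k + 1) Γ(β/2 + k + 1))`, `k ∈ ℤ`. -/
def gHat (β : ℝ) (k : ℤ) : ℝ :=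
  (-1 : ℝ) ^ k * Real.Gamma (β + 1) /
    (Real.Gamma (β / 2 - (k : ℝ) + 1) * Real.Gamma (β / 2 + (k : ℝ) + 1))

/-- The constant `r_β`. -/
def rBeta (β : ℝ) : ℝ :=
  Real.exp (-2) * ((4 - β) * (2 - β) * β / ((6 + β) * (4 + β) * (2 + β))) *
    (Real.Gamma (β + 1) / Real.Gamma (β / 2 + 1) ^ 2) * (3 + β / 2) ^ (β + 1)

/-- The constant `c_*^{(β)} = (2 / β) r_β`. -/
def cStar (β : ℝ) : ℝ := 2 / β * rBeta β

/-- Weights `c_l`, `0 ≤ l ≤ 2J`, of the composite trapezoid rule. -/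
def trapWeight (J l : ℕ) : ℝ := if l = 0 ∨ l = 2 * J then 1 / 2 else 1

/-- The step `Δα = 1 / (2J)`. -/
def dAlpha (J : ℕ) : ℝ := 1 / (2 * (J : ℝ))

/-- The nodes `α_l = 1 + l Δα`. -/
def alphaNode (J l : ℕ) : ℝ := 1 + (l : ℝ) * dAlpha J

/-- `γ_l = α_l - 1`. -/
def gammaNode (J l : ℕ) : ℝ := alphaNode J l - 1

/-- `halfAvg u n i` is `u_i^{n-1/2} = (u_i^n + u_i^{n-1}) / 2`, used for `n ≥ 1`. -/
def halfAvg (u : ℕ → ℕ → ℝ) (n i : ℕ) : ℝ := (u n i + u (n - 1) i) / 2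

/-- `halfDiff τ u n i` is `δ_t u_i^{n-1/2} = (u_i^n - u_i^{n-1}) / τ`, used for `n ≥ 1`. -/
def halfDiff (τ : ℝ) (u : ℕ → ℕ → ℝ) (n i : ℕ) : ℝ := (u n i - u (n - 1) i) / τ

/-- The discrete distributed-order time derivative at `(x_i, t_{n-1/2})`:
`Δα ∑_{l=0}^{2J} c_l ω(α_l) τ^{-γ_l} ∑_{k=0}^{n-1} λ_k^{(γ_l)} δ_t u_i^{n-k-1/2}`. -/
def timeOp (ω : ℝ → ℝ) (J : ℕ) (τ : ℝ) (u : ℕ → ℕ → ℝ) (n i : ℕ) : ℝ :=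
  dAlpha J * ∑ l ∈ Finset.range (2 * J + 1),
    trapWeight J l * ω (alphaNode J l) * (1 / τ ^ gammaNode J l) *
      ∑ k ∈ Finset.range n, lamCoef (gammaNode J l) k * halfDiff τ u (n - k) i

/-- `∑_{k=i-M}^{i} ĝ_k^{(β)} v_{i-k}`, written with the summation index `j = i - k`,
which runs through `0, …, M`. -/
def spaceSum (β : ℝ) (M : ℕ) (v : ℕ → ℝ) (i : ℕ) : ℝ :=
  ∑ j ∈ Finset.range (M + 1), gHat β ((i : ℤ) - (j : ℤ)) * v j

/-- `u` solves the difference scheme with order `β`, weight `ω`, coefficient `K`, mesh sizes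
`h = L / M`, `τ = T / N`, `Δα = 1 / (2J)`, source `G n i = G_i^n` and initial data `φ`. -/
structure IsSchemeSolution (β K L T : ℝ) (ω : ℝ → ℝ) (M N J : ℕ) (G : ℕ → ℕ → ℝ) (φ : ℕ → ℝ)
    (u : ℕ → ℕ → ℝ) : Prop where
  scheme : ∀ n i : ℕ, 1 ≤ n → n ≤ N → 1 ≤ i → i ≤ M - 1 →
    timeOp ω J (T / N) u n i =
      -(K * (L / M) ^ (-β) * spaceSum β M (halfAvg u n) i) + G n i
  initial : ∀ i : ℕ, 1 ≤ i → i ≤ M - 1 → u 0 i = φ i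
  boundary : ∀ n : ℕ, n ≤ N → u n 0 = 0 ∧ u n M = 0

/-- The squared discrete `L²` norm `‖v‖² = h ∑_{i=1}^{M-1} v_i²`. -/
def normSq (h : ℝ) (M : ℕ) (v : ℕ → ℝ) : ℝ := h * ∑ i ∈ Finset.Icc 1 (M - 1), v i ^ 2

/-- The semi-discrete Fourier transform `v̂(ξ) = (2π)^{-1/2} h ∑_j v_j e^{-i ξ x_j}` on `hℤ` of a
grid function `v_0, …, v_M` extended by zero. -/
def gridFourier (h : ℝ) (M : ℕ) (v : ℕ → ℝ) (ξ : ℝ) : ℂ :=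
  ((1 / √(2 * π) * h : ℝ) : ℂ) *
    ∑ j ∈ Finset.range (M + 1),
      (v j : ℂ) * Complex.exp (-(Complex.I * (ξ : ℂ) * (((j : ℝ) * h : ℝ) : ℂ)))

/-- The squared discrete fractional Sobolev seminorm
`|v|²_{H^σ} = ∫_{-π/h}^{π/h} |ξ|^{2σ} |v̂(ξ)|² dξ`. -/
def sobolevSemiSq (σ h : ℝ) (M : ℕ) (v : ℕ → ℝ) : ℝ :=
  ∫ ξ in (-(π / h))..(π / h), |ξ| ^ (2 * σ) * ‖gridFourier h M v ξ‖ ^ 2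

end FracWave

end

noncomputable section

namespace FracWave

theorem gCoef_eq_choose (γ : ℝ) (k : ℕ) : gCoef γ k = (-1) ^ k * Ring.choose γ k := by
  induction k with
  | zero => simp [gCoef]
  | succ k ih =>
    rw [gCoef, ih, Ring.choose_eq_smul, Ring.choose_eq_smul, descPochhammer_succ_right,
      Polynomial.smeval_mul, Nat.factorial_succ]
    have h1 : ((k : ℝ) + 1) ≠ 0 := by positivity
    have h2 : ((Nat.factorial k : ℕ) : ℝ) ≠ 0 := by positivity
    simp only [smul_eq_mul, Polynomial.smeval_sub, Polynomial.smeval_X, pow_one,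
      Polynomial.smeval_natCast, pow_zero]
    push_cast
    field_simp
    simp
    ring

theorem hasSum_gCoef (γ : ℝ) {z : ℂ} (hz : ‖z‖ < 1) :
    HasSum (fun k => (gCoef γ k : ℂ) * z ^ k) ((1 - z) ^ (γ : ℂ)) := by
  have h := (Complex.one_add_cpow_hasFPowerSeriesOnBall_zero (a := (γ : ℂ))).hasSum
    (y := -z) (by rw [← ENNReal.ofReal_one, Metric.eball_ofReal]; simpa using hz)
  rw [zero_add, ← sub_eq_add_neg] at h
  simp only [binomialSeries_apply] at h
  have e : (fun k => (gCoef γ k : ℂ) * z ^ k) =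
      fun n => Ring.choose (γ : ℂ) n • (List.ofFn fun _ : Fin n => -z).prod := by
    funext k
    simp [gCoef_eq_choose, neg_pow z, Complex.ofReal_choose]
    ring
  rw [e]
  exact h

theorem hasSum_lamCoef (γ : ℝ) {z : ℂ} (hz : ‖z‖ < 1) :
    HasSum (fun k => (lamCoef γ k : ℂ) * z ^ k)
      ((1 + γ / 2 * (1 - z)) * (1 - z) ^ (γ : ℂ)) := by
  have h := hasSum_gCoef γ hz
  rw [← hasSum_nat_add_iff' 1]
  have h1 := ((hasSum_nat_add_iff' 1).2 h).mul_left ((1 + γ / 2 : ℂ))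
  have h2 := (h.mul_left z).mul_left ((γ / 2 : ℂ))
  convert h1.sub h2 using 1
  · funext k
    simp [lamCoef]
    ring
  · simp [lamCoef, gCoef]
    ring

theorem re_symbol_nonneg {γ : ℝ} (h0 : 0 ≤ γ) (h1 : γ ≤ 1) {z : ℂ} (hz : ‖z‖ < 1) :
    0 ≤ ((1 + γ / 2 * (1 - z)) * (1 - z) ^ (γ : ℂ)).re := by
  set w : ℂ := 1 - z with hw
  set φ := Complex.arg w
  have hre : 0 < w.re := by
    have := Complex.re_le_norm z
    simp [hw]; linarith
  have hw0 : w ≠ 0 := by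
    intro h; rw [h] at hre; simp at hre
  have hn : 0 < ‖w‖ := norm_pos_iff.2 hw0
  have hnw : ‖w‖ ≤ 2 * Real.cos φ := by
    have e : ‖z‖ ^ 2 < 1 := by nlinarith [norm_nonneg z]
    have e1 : z = 1 - w := by simp [hw]
    rw [← Complex.normSq_eq_norm_sq, e1, Complex.normSq_apply] at e
    have e2 := Complex.normSq_eq_norm_sq w
    rw [Complex.normSq_apply] at e2
    simp at e
    have e3 := Complex.norm_mul_cos_arg w
    have : ‖w‖ * ‖w‖ ≤ ‖w‖ * (2 * Real.cos φ) := by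
      rw [mul_left_comm, e3]; nlinarith
    exact le_of_mul_le_mul_left this hn
  have hφ : |φ| < π / 2 := Complex.abs_arg_lt_pi_div_two_iff.2 (Or.inl hre)
  have hcos : Real.cos φ ≤ Real.cos (γ * φ) := by
    rw [← Real.cos_abs φ, ← Real.cos_abs (γ * φ), abs_mul, abs_of_nonneg h0]
    apply Real.cos_le_cos_of_nonneg_of_le_pi (by positivity)
    · linarith [Real.pi_pos]
    · nlinarith [abs_nonneg φ]
  have hcp : 0 < Real.cos φ := by linarith
  have hpow : w ^ (γ : ℂ) =
      ((‖w‖ ^ γ : ℝ) : ℂ) * (Real.cos (γ * φ) + Real.sin (γ * φ) * Complex.I) := by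
    rw [Complex.cpow_def_of_ne_zero hw0, Real.rpow_def_of_pos hn]
    push_cast
    rw [← Complex.exp_mul_I, ← Complex.exp_add, Complex.ofReal_log hn.le]
    congr 1
    rw [Complex.log]
    rw [Complex.ofReal_log hn.le]
    ring
  have h2 : ((1 + γ / 2 * w) * w ^ (γ : ℂ)).re = ‖w‖ ^ γ * (Real.cos (γ * φ) +
      γ / 2 * ‖w‖ * (Real.cos φ * Real.cos (γ * φ) - Real.sin φ * Real.sin (γ * φ))) := by
    have hwr : w.re = ‖w‖ * Real.cos φ := (Complex.norm_mul_cos_arg w).symm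
    have hwi : w.im = ‖w‖ * Real.sin φ := (Complex.norm_mul_sin_arg w).symm
    rw [hpow]
    have e : (γ / 2 : ℂ) = ((γ / 2 : ℝ) : ℂ) := by push_cast; rfl
    rw [e]
    simp only [Complex.mul_re, Complex.add_re, Complex.add_im, Complex.mul_im, Complex.ofReal_re,
      Complex.ofReal_im, Complex.one_re, Complex.one_im, Complex.I_re, Complex.I_im, hwr, hwi]
    ring
  rw [h2]
  apply mul_nonneg (by positivity)
  have hs : Real.sin φ * Real.sin (γ * φ) ≤ 1 := by
    have a := Real.sin_sq_le_one φ
    have b := Real.sin_sq_le_one (γ * φ)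
    nlinarith [sq_nonneg (Real.sin φ - Real.sin (γ * φ))]
  have hg : γ / 2 * ‖w‖ ≤ Real.cos φ := by nlinarith
  have hg0 : 0 ≤ γ / 2 * ‖w‖ := by positivity
  have h3 : 0 ≤ γ / 2 * ‖w‖ * (Real.cos φ * Real.cos (γ * φ)) :=
    mul_nonneg hg0 (mul_nonneg hcp.le (hcp.le.trans hcos))
  nlinarith [mul_nonneg hg0 (sub_nonneg.2 hs)]

/-- The squared modulus of a real trigonometric polynomial. -/
theorem normSq_trigPoly (m : ℕ) (v : ℕ → ℝ) (θ : ℝ) :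
    ∑ p ∈ Finset.range m, ∑ q ∈ Finset.range m, v p * v q * Real.cos (((p : ℝ) - q) * θ) =
      (∑ p ∈ Finset.range m, v p * Real.cos (p * θ)) ^ 2 +
        (∑ p ∈ Finset.range m, v p * Real.sin (p * θ)) ^ 2 := by
  rw [sq, sq, Finset.sum_mul_sum, Finset.sum_mul_sum, ← Finset.sum_add_distrib]
  refine Finset.sum_congr rfl fun p _ => ?_
  rw [← Finset.sum_add_distrib]
  refine Finset.sum_congr rfl fun q _ => ?_
  rw [sub_mul, Real.cos_sub]
  ring

theorem integral_cos_int_mul (n : ℤ) :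
    ∫ θ in (-π)..π, Real.cos (n * θ) = if n = 0 then 2 * π else 0 := by
  split_ifs with h
  · simp [h]; ring
  · have h' : (n : ℝ) ≠ 0 := by exact_mod_cast h
    rw [intervalIntegral.integral_comp_mul_left (f := Real.cos) h']
    simp [integral_cos, Real.sin_int_mul_pi]

theorem integral_cos_mul_cos (k p q : ℕ) :
    ∫ θ in (-π)..π, Real.cos (k * θ) * Real.cos (((p : ℝ) - q) * θ) =
      π * ((if p = q + k then 1 else 0) + (if q = p + k then 1 else 0)) := by
  have h : ∀ θ : ℝ, Real.cos (k * θ) * Real.cos (((p : ℝ) - q) * θ) =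
      (Real.cos (((q + k - p : ℤ) : ℝ) * θ) + Real.cos (((p + k - q : ℤ) : ℝ) * θ)) / 2 := by
    intro θ
    push_cast
    rw [show ((q : ℝ) + k - p) * θ = k * θ - (p - q) * θ by ring,
      show ((p : ℝ) + k - q) * θ = k * θ + (p - q) * θ by ring, Real.cos_sub, Real.cos_add]
    ring
  simp_rw [h]
  rw [intervalIntegral.integral_div, intervalIntegral.integral_add
    (Continuous.intervalIntegrable (by fun_prop) _ _)
    (Continuous.intervalIntegrable (by fun_prop) _ _), integral_cos_int_mul, integral_cos_int_mul]
  have e1 : ((q : ℤ) + k - p = 0) ↔ p = q + k := by omega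
  have e2 : ((p : ℤ) + k - q = 0) ↔ q = p + k := by omega
  simp only [e1, e2]
  split_ifs <;> ring

/-- A summable sequence whose generating function has nonnegative real part on the unit circle
is of positive type. -/
theorem convolution_form_nonneg_of_summable {a : ℕ → ℝ} (ha : Summable fun k => |a k|)
    (hpos : ∀ θ : ℝ, 0 ≤ ∑' k, a k * Real.cos (k * θ)) (m : ℕ) (v : ℕ → ℝ) :
    0 ≤ ∑ n ∈ Finset.range m, (∑ k ∈ Finset.range (n + 1), a k * v (n - k)) * v n := by
  set V : ℝ → ℝ := fun θ => ∑ p ∈ Finset.range m, ∑ q ∈ Finset.range m,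
    v p * v q * Real.cos (((p : ℝ) - q) * θ) with hV
  have hVc : Continuous V := by simp only [hV]; fun_prop
  have hV0 : ∀ θ, 0 ≤ V θ := fun θ => by
    simp only [hV]; rw [normSq_trigPoly]; positivity
  obtain ⟨B, hB⟩ : ∃ B, ∀ θ, V θ ≤ B := by
    refine ⟨∑ p ∈ Finset.range m, ∑ q ∈ Finset.range m, |v p * v q|, fun θ => ?_⟩
    refine Finset.sum_le_sum fun p _ => Finset.sum_le_sum fun q _ => ?_
    refine (le_abs_self _).trans ?_
    rw [abs_mul]
    exact mul_le_of_le_one_right (abs_nonneg _) (Real.abs_cos_le_one _)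
  have hI : ∀ k : ℕ, ∫ θ in (-π)..π, a k * Real.cos (k * θ) * V θ =
      2 * π * (a k * ∑ p ∈ Finset.range m, ∑ q ∈ Finset.range m,
        if p = q + k then v p * v q else 0) := by
    intro k
    have e : ∀ θ : ℝ, a k * Real.cos (k * θ) * V θ = ∑ p ∈ Finset.range m, ∑ q ∈ Finset.range m,
        a k * (v p * v q) * (Real.cos (k * θ) * Real.cos (((p : ℝ) - q) * θ)) := by
      intro θ
      simp only [hV, Finset.mul_sum]
      refine Finset.sum_congr rfl fun p _ => Finset.sum_congr rfl fun q _ => ?_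
      ring
    simp_rw [e]
    rw [intervalIntegral.integral_finsetSum
      (fun p _ => Continuous.intervalIntegrable (by fun_prop) _ _)]
    have e2 : ∀ p ∈ Finset.range m, ∫ θ in (-π)..π, ∑ q ∈ Finset.range m,
        a k * (v p * v q) * (Real.cos (k * θ) * Real.cos (((p : ℝ) - q) * θ)) =
        ∑ q ∈ Finset.range m, (π * a k * (if p = q + k then v p * v q else 0)
          + π * a k * (if q = p + k then v q * v p else 0)) := by
      intro p _
      rw [intervalIntegral.integral_finsetSum
        (fun q _ => Continuous.intervalIntegrable (by fun_prop) _ _)]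
      refine Finset.sum_congr rfl fun q _ => ?_
      rw [intervalIntegral.integral_const_mul, integral_cos_mul_cos]
      split_ifs <;> ring
    rw [Finset.sum_congr rfl e2]
    simp only [Finset.sum_add_distrib, ← Finset.mul_sum]
    rw [Finset.sum_comm (f := fun p q => if q = p + k then v q * v p else 0)]
    ring
  have hsum : HasSum (fun k => ∫ θ in (-π)..π, a k * Real.cos (k * θ) * V θ)
      (∫ θ in (-π)..π, ∑' k, a k * Real.cos (k * θ) * V θ) := by
    refine intervalIntegral.hasSum_integral_of_dominated_convergence
      (fun k _ => |a k| * B) (fun k => Continuous.aestronglyMeasurable (by fun_prop)) ?_ ?_ ?_ ?_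
    · refine fun k => Filter.Eventually.of_forall fun θ _ => ?_
      rw [norm_mul, norm_mul, Real.norm_eq_abs, Real.norm_eq_abs, Real.norm_eq_abs,
        abs_of_nonneg (hV0 θ)]
      exact mul_le_mul (mul_le_of_le_one_right (abs_nonneg _) (Real.abs_cos_le_one _)) (hB θ)
        (hV0 θ) (abs_nonneg _)
    · exact Filter.Eventually.of_forall fun θ _ => ha.mul_right B
    · exact intervalIntegrable_const
    · refine Filter.Eventually.of_forall fun θ _ => Summable.hasSum ?_
      refine Summable.mul_right _ (Summable.of_norm_bounded ha fun k => ?_)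
      rw [norm_mul, Real.norm_eq_abs, Real.norm_eq_abs]
      exact mul_le_of_le_one_right (abs_nonneg _) (Real.abs_cos_le_one _)
  have hnn : 0 ≤ ∫ θ in (-π)..π, ∑' k, a k * Real.cos (k * θ) * V θ := by
    refine intervalIntegral.integral_nonneg (by linarith [Real.pi_pos]) fun θ _ => ?_
    rw [tsum_mul_right]
    exact mul_nonneg (hpos θ) (hV0 θ)
  rw [← hsum.tsum_eq, tsum_congr hI, tsum_mul_left] at hnn
  have hfin : ∀ k ∉ Finset.range m, (a k * ∑ p ∈ Finset.range m, ∑ q ∈ Finset.range m,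
      if p = q + k then v p * v q else 0) = 0 := by
    intro k hk
    rw [Finset.mem_range] at hk
    rw [Finset.sum_eq_zero, mul_zero]
    intro p hp
    refine Finset.sum_eq_zero fun q _ => if_neg ?_
    rw [Finset.mem_range] at hp
    omega
  rw [tsum_eq_sum hfin] at hnn
  have h2 := nonneg_of_mul_nonneg_right hnn (by positivity)
  refine h2.trans_eq ?_
  simp only [Finset.mul_sum]
  rw [Finset.sum_comm]
  refine Finset.sum_congr rfl fun n hn => ?_
  rw [Finset.mem_range] at hn
  rw [Finset.sum_mul]
  symm
  rw [← Finset.sum_subset (Finset.range_subset_range.2 (show n + 1 ≤ m from hn))]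
  · refine Finset.sum_congr rfl fun k hk => ?_
    rw [Finset.mem_range] at hk
    rw [Finset.sum_eq_single (n - k)]
    · rw [if_pos (by omega)]; ring
    · intro q _ hq
      rw [if_neg (by omega), mul_zero]
    · intro h
      simp at h
      omega
  · intro k _ hk
    rw [Finset.mem_range] at hk
    refine Finset.sum_eq_zero fun q _ => ?_
    rw [if_neg (by omega), mul_zero]

theorem lamCoef_form_nonneg {γ : ℝ} (h0 : 0 ≤ γ) (h1 : γ ≤ 1) (m : ℕ) (v : ℕ → ℝ) :
    0 ≤ ∑ n ∈ Finset.range m, (∑ k ∈ Finset.range (n + 1), lamCoef γ k * v (n - k)) * v n := by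
  have key : ∀ r : ℝ, 0 ≤ r → r < 1 → 0 ≤ ∑ n ∈ Finset.range m,
      (∑ k ∈ Finset.range (n + 1), (lamCoef γ k * r ^ k) * v (n - k)) * v n := by
    intro r hr0 hr1
    apply convolution_form_nonneg_of_summable
    · have hs := (hasSum_lamCoef γ (z := (r : ℂ)) (by simpa [abs_of_nonneg hr0])).summable.norm
      refine hs.congr fun k => ?_
      simp [abs_mul]
    · intro θ
      set z : ℂ := r * Complex.exp (θ * Complex.I) with hz
      have hzn : ‖z‖ < 1 := by
        rw [hz, norm_mul, Complex.norm_exp_ofReal_mul_I]; simpa [abs_of_nonneg hr0]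
      have hs := Complex.hasSum_re (hasSum_lamCoef γ hzn)
      have e : ∀ k : ℕ, ((lamCoef γ k : ℂ) * z ^ k).re =
          lamCoef γ k * r ^ k * Real.cos (k * θ) := by
        intro k
        rw [hz, mul_pow, ← Complex.exp_nat_mul, ← mul_assoc (k : ℂ), ← mul_assoc]
        have : (lamCoef γ k : ℂ) * r ^ k = ((lamCoef γ k * r ^ k : ℝ) : ℂ) := by push_cast; rfl
        rw [this, Complex.re_ofReal_mul]
        have : (k : ℂ) * θ = ((k * θ : ℝ) : ℂ) := by push_cast; rfl
        rw [this, Complex.exp_ofReal_mul_I_re]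
      simp only [e] at hs
      rw [hs.tsum_eq]
      exact re_symbol_nonneg h0 h1 hzn
  set Q : ℝ → ℝ := fun r => ∑ n ∈ Finset.range m,
      (∑ k ∈ Finset.range (n + 1), (lamCoef γ k * r ^ k) * v (n - k)) * v n with hQ
  have hQc : Continuous Q := by simp only [hQ]; fun_prop
  have ht : Filter.Tendsto Q (nhdsWithin 1 (Set.Iio 1)) (nhds (Q 1)) :=
    (hQc.tendsto 1).mono_left nhdsWithin_le_nhds
  have h2 : 0 ≤ Q 1 := by
    refine ge_of_tendsto ht ?_
    have : Set.Ioo (0 : ℝ) 1 ∈ nhdsWithin (1 : ℝ) (Set.Iio 1) := Ioo_mem_nhdsLT (by norm_num)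
    filter_upwards [this] with r hr
    exact key r hr.1.le hr.2
  simpa [hQ] using h2

theorem gHat_neg (β : ℝ) (k : ℤ) : gHat β (-k) = gHat β k := by
  unfold gHat
  rw [zpow_neg, mul_comm (Real.Gamma (β / 2 - _ + 1)), ← inv_zpow]
  push_cast
  rw [sub_neg_eq_add, ← sub_eq_add_neg]
  norm_num

theorem half_add_int_ne_zero {β : ℝ} (h1 : 0 < β) (h2 : β < 2) (k : ℤ) : β / 2 + k ≠ 0 := by
  intro h
  have a : (k : ℝ) < 0 := by linarith
  have b : (-1 : ℝ) < k := by linarith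
  have a' : k < 0 := by exact_mod_cast a
  have b' : -1 < k := by exact_mod_cast b
  omega

theorem gHat_succ {β : ℝ} (h1 : 0 < β) (h2 : β < 2) (k : ℤ) :
    gHat β (k + 1) * (k + 1 + β / 2) = gHat β k * (k - β / 2) := by
  have e1 : β / 2 - k ≠ 0 := by
    have := half_add_int_ne_zero h1 h2 (-k); push_cast at this; rwa [← sub_eq_add_neg] at this
  have e2 : β / 2 + k + 1 ≠ 0 := by
    have := half_add_int_ne_zero h1 h2 (k + 1); push_cast at this; rwa [← add_assoc] at this
  have G1 := Real.Gamma_add_one e1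
  have G2 := Real.Gamma_add_one e2
  unfold gHat
  push_cast
  rw [show β / 2 - ((k : ℝ) + 1) + 1 = β / 2 - k by ring, ← add_assoc (β / 2), G1, G2,
    zpow_add_one₀ (by norm_num)]
  have e3 : (k : ℝ) + 1 + β / 2 = β / 2 + k + 1 := by ring
  have e4 : (k : ℝ) - β / 2 = -(β / 2 - k) := by ring
  rw [e3, e4]
  by_cases hG : Real.Gamma (β / 2 - k) = 0
  · simp [hG]
  by_cases hG' : Real.Gamma (β / 2 + k + 1) = 0
  · simp [hG']
  generalize Real.Gamma (β / 2 - k) = A at *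
  generalize Real.Gamma (β / 2 + k + 1) = B at *
  generalize β / 2 - (k : ℝ) = a at *
  generalize β / 2 + (k : ℝ) + 1 = b at *
  field_simp

theorem gHat_zero (β : ℝ) : gHat β 0 = Real.Gamma (β + 1) / Real.Gamma (β / 2 + 1) ^ 2 := by
  simp [gHat, sq]

theorem gHat_zero_pos {β : ℝ} (h1 : 0 < β) : 0 < gHat β 0 := by
  rw [gHat_zero]
  have := Real.Gamma_pos_of_pos (show 0 < β + 1 by linarith)
  have := Real.Gamma_pos_of_pos (show 0 < β / 2 + 1 by linarith)
  positivity

theorem gHat_nat_neg {β : ℝ} (h1 : 0 < β) (h2 : β < 2) (k : ℕ) : gHat β (k + 1) < 0 := by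
  induction k with
  | zero =>
    have h := gHat_succ h1 h2 0
    have h0 := gHat_zero_pos h1
    simp only [Int.cast_zero, zero_add, zero_sub, CharP.cast_eq_zero] at h ⊢
    have : gHat β 1 * (1 + β / 2) < 0 := by rw [h]; nlinarith
    by_contra hc
    nlinarith [not_lt.1 hc]
  | succ k ih =>
    have h := gHat_succ h1 h2 ((k : ℤ) + 1)
    push_cast at h ⊢
    have hk : (0 : ℝ) ≤ k := Nat.cast_nonneg k
    have : gHat β (k + 1 + 1) * (k + 1 + 1 + β / 2) < 0 := by
      rw [h]; exact mul_neg_of_neg_of_pos ih (by linarith)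
    by_contra hc
    have := mul_nonneg (not_lt.1 hc) (show (0 : ℝ) ≤ k + 1 + 1 + β / 2 by linarith)
    linarith

theorem gHat_nonpos {β : ℝ} (h1 : 0 < β) (h2 : β < 2) {k : ℤ} (hk : k ≠ 0) : gHat β k ≤ 0 := by
  have key : ∀ n : ℕ, n ≠ 0 → gHat β n ≤ 0 := by
    intro n hn
    obtain ⟨m, rfl⟩ := Nat.exists_eq_succ_of_ne_zero hn
    have := gHat_nat_neg h1 h2 m
    push_cast; exact this.le
  obtain ⟨n, rfl | rfl⟩ := Int.eq_nat_or_neg k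
  · exact key n (by omega)
  · rw [gHat_neg]; exact key n (by omega)

/-- The tail `∑_{j ≥ k} |ĝ_j|`, `k ≥ 1`, in closed form. -/
def gHatTail (β : ℝ) (k : ℤ) : ℝ := -(gHat β k * (k + β / 2) / β)

theorem gHatTail_succ {β : ℝ} (h1 : 0 < β) (h2 : β < 2) (k : ℤ) :
    gHatTail β (k + 1) = gHatTail β k + gHat β k := by
  have h := gHat_succ h1 h2 k
  unfold gHatTail
  push_cast
  rw [h]
  field_simp
  ring

theorem gHatTail_one_sub {β : ℝ} (h1 : 0 < β) (h2 : β < 2) (k : ℤ) :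
    gHatTail β (1 - k) = -gHatTail β k := by
  have h := gHat_succ h1 h2 (k - 1)
  have e : gHat β (1 - k) = gHat β (k - 1) := by rw [← gHat_neg]; congr 1; ring
  unfold gHatTail
  rw [e]
  push_cast at h ⊢
  rw [sub_add_cancel, sub_add_cancel] at h
  rw [h]
  field_simp
  ring

theorem gHatTail_le_of_le {β : ℝ} (h1 : 0 < β) (h2 : β < 2) {k : ℕ} (hk : 1 ≤ k) {n : ℕ}
    (hkn : k ≤ n) : gHatTail β n ≤ gHatTail β k := by
  induction n, hkn using Nat.le_induction with
  | base => exact le_rfl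
  | succ n hn ih =>
    have := gHatTail_succ h1 h2 n
    push_cast
    rw [this]
    have := gHat_nonpos h1 h2 (k := n) (by omega)
    linarith

theorem sum_gHat_row {β : ℝ} (h1 : 0 < β) (h2 : β < 2) (i : ℤ) (m : ℕ) :
    ∑ j ∈ Finset.Icc 1 m, gHat β (i - (j : ℕ)) =
      gHatTail β i + gHatTail β (m + 1 - i) := by
  induction m with
  | zero =>
    have := gHatTail_one_sub h1 h2 i
    simp [this]
  | succ m ih =>
    rw [Finset.sum_Icc_succ_top (by omega), ih]
    have := gHatTail_succ h1 h2 (m + 1 - i)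
    have e : gHat β (i - (m + 1 : ℕ)) = gHat β (m + 1 - i) := by
      rw [← gHat_neg]; congr 1; push_cast; ring
    rw [e, add_assoc, ← this]
    congr 2
    push_cast
    ring

theorem gHat_form_ge_tail {β : ℝ} (h1 : 0 < β) (h2 : β < 2) (m : ℕ) (v : ℕ → ℝ) :
    2 * gHatTail β (m + 1) * ∑ i ∈ Finset.Icc 1 m, v i ^ 2 ≤
      ∑ i ∈ Finset.Icc 1 m, ∑ j ∈ Finset.Icc 1 m, gHat β ((i : ℤ) - (j : ℤ)) * v i * v j := by
  have hrow : ∀ i ∈ Finset.Icc 1 m, 2 * gHatTail β (m + 1) ≤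
      ∑ j ∈ Finset.Icc 1 m, gHat β ((i : ℤ) - (j : ℤ)) := by
    intro i hi
    rw [Finset.mem_Icc] at hi
    rw [sum_gHat_row h1 h2]
    have a := gHatTail_le_of_le h1 h2 (k := i) (n := m + 1) (by omega) (by omega)
    have b := gHatTail_le_of_le h1 h2 (k := m + 1 - i) (n := m + 1) (by omega) (by omega)
    rw [Nat.cast_sub (by omega)] at b
    push_cast at a b
    linarith
  have hcross : ∑ i ∈ Finset.Icc 1 m, ∑ j ∈ Finset.Icc 1 m,
        gHat β ((i : ℤ) - (j : ℤ)) * ((v i ^ 2 + v j ^ 2) / 2) ≤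
      ∑ i ∈ Finset.Icc 1 m, ∑ j ∈ Finset.Icc 1 m, gHat β ((i : ℤ) - (j : ℤ)) * v i * v j := by
    refine Finset.sum_le_sum fun i _ => Finset.sum_le_sum fun j _ => ?_
    by_cases hij : i = j
    · subst hij
      exact le_of_eq (by ring)
    · have := gHat_nonpos h1 h2 (k := (i : ℤ) - j) (by omega)
      nlinarith [mul_nonneg (neg_nonneg.2 this) (sq_nonneg (v i - v j))]
  have hsymm : ∑ i ∈ Finset.Icc 1 m, ∑ j ∈ Finset.Icc 1 m,
        gHat β ((i : ℤ) - (j : ℤ)) * ((v i ^ 2 + v j ^ 2) / 2) =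
      ∑ i ∈ Finset.Icc 1 m, (∑ j ∈ Finset.Icc 1 m, gHat β ((i : ℤ) - (j : ℤ))) * v i ^ 2 := by
    have e : ∑ i ∈ Finset.Icc 1 m, ∑ j ∈ Finset.Icc 1 m,
        gHat β ((i : ℤ) - (j : ℤ)) * v j ^ 2 = ∑ i ∈ Finset.Icc 1 m, ∑ j ∈ Finset.Icc 1 m,
        gHat β ((i : ℤ) - (j : ℤ)) * v i ^ 2 := by
      rw [Finset.sum_comm]
      refine Finset.sum_congr rfl fun i _ => Finset.sum_congr rfl fun j _ => ?_
      rw [← gHat_neg, neg_sub]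
    simp only [Finset.sum_mul]
    simp only [mul_div_assoc', mul_add, ← Finset.sum_div, Finset.sum_add_distrib, e]
    ring
  refine le_trans ?_ hcross
  rw [hsymm, Finset.mul_sum]
  exact Finset.sum_le_sum fun i hi => mul_le_mul_of_nonneg_right (hrow i hi) (sq_nonneg _)

theorem one_sub_rpow_mul_le {β x : ℝ} (h1 : 1 ≤ β) (h2 : β ≤ 2) (hx0 : 0 ≤ x) (hx1 : x ≤ 1) :
    (1 - x) ^ β * (1 + β / 2 * x) ≤ 1 - β / 2 * x := by
  have hb : (1 - x) ^ (β - 1) ≤ 1 - (β - 1) * x := by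
    have := _root_.rpow_one_add_le_one_add_mul_self (s := -x) (by linarith) (p := β - 1)
      (by linarith) (by linarith)
    simpa [sub_eq_add_neg] using this
  have hp : (1 - x) ^ β ≤ (1 - x) * (1 - (β - 1) * x) := by
    rcases eq_or_lt_of_le hx1 with h | h
    · subst h; simp [Real.zero_rpow (show β ≠ 0 by linarith)]
    · have : (1 - x) ^ β = (1 - x) * (1 - x) ^ (β - 1) := by
        rw [Real.rpow_sub_one (by linarith)]
        field_simp [show (1 - x) ≠ 0 by linarith]
      rw [this]
      exact mul_le_mul_of_nonneg_left hb (by linarith)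
  have hpos : 0 ≤ 1 + β / 2 * x := by positivity
  refine (mul_le_mul_of_nonneg_right hp hpos).trans ?_
  have e : (1 - x) * (1 - (β - 1) * x) * (1 + β / 2 * x) = 1 - β / 2 * x
      - x ^ 2 * ((1 - β / 2) + β / 2 * (β - 1) * (1 - x)) := by ring
  rw [e]
  have : 0 ≤ x ^ 2 * ((1 - β / 2) + β / 2 * (β - 1) * (1 - x)) := by
    apply mul_nonneg (sq_nonneg _)
    have : 0 ≤ β / 2 * (β - 1) * (1 - x) :=
      mul_nonneg (mul_nonneg (by linarith) (by linarith)) (by linarith)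
    linarith
  linarith

theorem sub_one_rpow_mul_le {β k : ℝ} (h1 : 1 ≤ β) (h2 : β ≤ 2) (hk : 1 ≤ k) :
    (k - 1) ^ β * (k + β / 2) ≤ k ^ β * (k - β / 2) := by
  have hk0 : 0 < k := by linarith
  have h := one_sub_rpow_mul_le h1 h2 (x := 1 / k) (by positivity)
    (by rw [div_le_one hk0]; exact hk)
  have e : 1 - 1 / k = (k - 1) / k := by field_simp
  rw [e, Real.div_rpow (by linarith) hk0.le] at h
  have hkp := Real.rpow_pos_of_pos hk0 β
  have := mul_le_mul_of_nonneg_left h (show 0 ≤ k ^ β * k by positivity)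
  calc _ = k ^ β * k * ((k - 1) ^ β / k ^ β * (1 + β / 2 * (1 / k))) := by field_simp
    _ ≤ _ := this
    _ = _ := by field_simp

theorem gHat_three_bound {β : ℝ} (h1 : 1 < β) (h2 : β < 2) {M : ℕ} (hM : 2 ≤ M) :
    -gHat β 3 * (3 + β / 2) * 2 ^ β ≤ -gHat β M * (M + β / 2) * (M : ℝ) ^ β := by
  have h0 : 0 < β := by linarith
  have hM' : 2 = M ∨ 3 ≤ M := by omega
  rcases hM' with rfl | hM3
  · have h := gHat_succ h0 h2 2
    have hn := gHat_nonpos h0 h2 (k := 2) (by norm_num)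
    norm_num at h ⊢
    rw [h]
    have hp : (0 : ℝ) < 2 ^ β := by positivity
    exact mul_le_mul_of_nonneg_right (by nlinarith) hp.le
  · have key : -gHat β 3 * (3 + β / 2) * 2 ^ β ≤ -gHat β M * (M + β / 2) * ((M : ℝ) - 1) ^ β := by
      induction M, hM3 using Nat.le_induction with
      | base => norm_num
      | succ k hk ih =>
        refine (ih (by omega)).trans ?_
        have h := gHat_succ h0 h2 k
        have hn := gHat_nonpos h0 h2 (k := k) (by omega)
        have hk1 : (1 : ℝ) ≤ k := by exact_mod_cast (by omega : 1 ≤ k)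
        have hs := mul_le_mul_of_nonneg_left (sub_one_rpow_mul_le h1.le h2.le hk1)
          (neg_nonneg.2 hn)
        push_cast at h ⊢
        rw [add_sub_cancel_right, neg_mul (gHat β (k + 1)), h]
        linarith
    refine key.trans ?_
    have hn := gHat_nonpos h0 h2 (k := M) (by omega)
    have hk1 : (3 : ℝ) ≤ M := by exact_mod_cast hM3
    refine mul_le_mul_of_nonneg_left (Real.rpow_le_rpow (by linarith) (by linarith) h0.le) ?_
    exact mul_nonneg (neg_nonneg.2 hn) (by positivity)

theorem rBeta_eq {β : ℝ} (h1 : 0 < β) (h2 : β < 2) :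
    rBeta β = Real.exp (-2) * (-gHat β 3) * (3 + β / 2) ^ (β + 1) := by
  have a := gHat_succ h1 h2 0
  have b := gHat_succ h1 h2 1
  have c := gHat_succ h1 h2 2
  norm_num at a b c
  have a' : gHat β 1 = -(gHat β 0 * (β / 2)) / (1 + β / 2) := by
    rw [← a]; field_simp
  have b' : gHat β 2 = gHat β 1 * (1 - β / 2) / (2 + β / 2) := by
    rw [← b]; field_simp
  have c' : gHat β 3 = gHat β 2 * (2 - β / 2) / (3 + β / 2) := by
    rw [← c]; field_simp
  have : -gHat β 3 = (4 - β) * (2 - β) * β / ((6 + β) * (4 + β) * (2 + β)) * gHat β 0 := by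
    rw [c', b', a']
    field_simp
    ring
  rw [this, rBeta, gHat_zero]
  ring

theorem rBeta_pos {β : ℝ} (h1 : 0 < β) (h2 : β < 2) : 0 < rBeta β := by
  rw [rBeta_eq h1 h2]
  have := gHat_nat_neg h1 h2 2
  norm_num at this
  have : 0 < -gHat β 3 := by linarith
  positivity

theorem cStar_pos {β : ℝ} (h1 : 0 < β) (h2 : β < 2) : 0 < cStar β :=
  mul_pos (by positivity) (rBeta_pos h1 h2)

theorem rBeta_le {β : ℝ} (h1 : 1 < β) (h2 : β < 2) :
    rBeta β ≤ -gHat β 3 * (3 + β / 2) * 2 ^ β := by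
  have h0 : 0 < β := by linarith
  have hn := gHat_nonpos h0 h2 (k := 3) (by norm_num)
  rw [rBeta_eq h0 h2, Real.rpow_add_one (by positivity)]
  have h4 : (3 + β / 2) ^ β ≤ 2 ^ β * 4 := by
    calc (3 + β / 2) ^ β ≤ 4 ^ β := Real.rpow_le_rpow (by positivity) (by linarith) h0.le
      _ = 2 ^ β * 2 ^ β := by rw [← Real.mul_rpow (by norm_num) (by norm_num)]; norm_num
      _ ≤ 2 ^ β * 2 ^ (2 : ℝ) := by
        gcongr
        norm_num
      _ = 2 ^ β * 4 := by norm_num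
  have he : Real.exp (-2) * 4 ≤ 1 := by
    have a := Real.add_one_le_exp (1 : ℝ)
    have b : Real.exp 2 = Real.exp 1 * Real.exp 1 := by rw [← Real.exp_add]; norm_num
    rw [Real.exp_neg, inv_mul_le_one₀ (Real.exp_pos _), b]
    nlinarith
  have hp : (0 : ℝ) < 2 ^ β := by positivity
  have h5 : Real.exp (-2) * (3 + β / 2) ^ β ≤ 2 ^ β := by
    have := mul_le_mul_of_nonneg_left h4 (Real.exp_pos (-2)).le
    nlinarith
  have := mul_le_mul_of_nonneg_left h5
    (mul_nonneg (neg_nonneg.2 hn) (show (0 : ℝ) ≤ 3 + β / 2 by positivity))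
  linarith

theorem cStar_le_gHatTail {β : ℝ} (h1 : 1 < β) (h2 : β < 2) {M : ℕ} (hM : 2 ≤ M) :
    cStar β ≤ 2 * gHatTail β M * (M : ℝ) ^ β := by
  have h := (rBeta_le h1 h2).trans (gHat_three_bound h1 h2 hM)
  have h0 : 0 < β := by linarith
  have := mul_le_mul_of_nonneg_left h (show 0 ≤ 2 / β by positivity)
  unfold cStar gHatTail
  refine this.trans_eq ?_
  push_cast
  field_simp

/-- Coercivity of the fractional centered difference operator on a grid with `M` cells. -/
theorem gHat_form_coercive {β : ℝ} (h1 : 1 < β) (h2 : β < 2) (M : ℕ) (v : ℕ → ℝ) :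
    cStar β * (M : ℝ) ^ (-β) * ∑ i ∈ Finset.Icc 1 (M - 1), v i ^ 2 ≤
      ∑ i ∈ Finset.Icc 1 (M - 1), ∑ j ∈ Finset.Icc 1 (M - 1),
        gHat β ((i : ℤ) - (j : ℤ)) * v i * v j := by
  by_cases hM : 2 ≤ M
  · refine le_trans ?_ (gHat_form_ge_tail (by linarith) h2 (M - 1) v)
    refine mul_le_mul_of_nonneg_right ?_ (Finset.sum_nonneg fun i _ => sq_nonneg _)
    have hM0 : (0 : ℝ) < M := by exact_mod_cast (by omega : 0 < M)
    have h := cStar_le_gHatTail h1 h2 hM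
    rw [Real.rpow_neg hM0.le, ← div_eq_mul_inv, div_le_iff₀ (by positivity)]
    have : ((M - 1 : ℕ) : ℤ) + 1 = M := by omega
    rw [this]
    exact h
  · have : Finset.Icc 1 (M - 1) = ∅ := Finset.Icc_eq_empty (by omega)
    simp [this]

theorem integral_rpow_mul_one_sub_rpow {a b : ℝ} (ha : 0 < a) (hb : 0 < b) :
    ∫ x in (0 : ℝ)..1, x ^ (a - 1) * (1 - x) ^ (b - 1) =
      Real.Gamma a * Real.Gamma b / Real.Gamma (a + b) := by
  have h := ProbabilityTheory.beta_eq_betaIntegralReal a b ha hb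
  rw [ProbabilityTheory.beta] at h
  rw [h, Complex.betaIntegral]
  have e : ∫ x in (0 : ℝ)..1, (x : ℂ) ^ ((a : ℂ) - 1) * (1 - (x : ℂ)) ^ ((b : ℂ) - 1) =
      ∫ x in (0 : ℝ)..1, ((x ^ (a - 1) * (1 - x) ^ (b - 1) : ℝ) : ℂ) := by
    refine intervalIntegral.integral_congr fun x hx => ?_
    rw [Set.uIcc_of_le zero_le_one] at hx
    push_cast
    rw [Complex.ofReal_cpow hx.1, Complex.ofReal_cpow (by linarith [hx.2])]
    push_cast
    rfl
  rw [e, intervalIntegral.integral_ofReal, Complex.ofReal_re]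

theorem integral_sin_half_rpow {β : ℝ} (hβ : 0 < β) :
    2 ^ β * ∫ t in (0 : ℝ)..π, Real.sin (t / 2) ^ β =
      π * (Real.Gamma (β + 1) / Real.Gamma (β / 2 + 1) ^ 2) := by
  have hpi := Real.pi_pos
  have hder : ∀ t ∈ Set.Ioo (0 : ℝ) π, HasDerivWithinAt (fun t : ℝ => Real.sin (t / 2) ^ 2)
      (Real.sin (t / 2) * Real.cos (t / 2)) (Set.Ioo 0 π) t := by
    intro t _
    have h := ((Real.hasDerivAt_sin (t / 2)).comp t ((hasDerivAt_id t).div_const 2)).pow 2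
    refine (h.congr_deriv ?_).hasDerivWithinAt
    simp
    ring
  have hinj : Set.InjOn (fun t : ℝ => Real.sin (t / 2) ^ 2) (Set.Ioo 0 π) := by
    intro x hx y hy hxy
    have sx := Real.sin_pos_of_pos_of_lt_pi (x := x / 2) (by linarith [hx.1]) (by linarith [hx.2])
    have sy := Real.sin_pos_of_pos_of_lt_pi (x := y / 2) (by linarith [hy.1]) (by linarith [hy.2])
    have h := (sq_eq_sq₀ sx.le sy.le).1 hxy
    have := Real.injOn_sin ⟨by linarith [hx.1], by linarith [hx.2]⟩
      ⟨by linarith [hy.1], by linarith [hy.2]⟩ h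
    linarith
  have himg : (fun t : ℝ => Real.sin (t / 2) ^ 2) '' Set.Ioo 0 π = Set.Ioo 0 1 := by
    ext x
    constructor
    · rintro ⟨t, ht, rfl⟩
      have s := Real.sin_pos_of_pos_of_lt_pi (x := t / 2) (by linarith [ht.1]) (by linarith [ht.2])
      have c := Real.cos_pos_of_mem_Ioo (x := t / 2) ⟨by linarith [ht.1], by linarith [ht.2]⟩
      have := Real.sin_sq_add_cos_sq (t / 2)
      exact ⟨by positivity, by nlinarith⟩
    · intro hx
      have h0 : 0 < √x := Real.sqrt_pos.2 hx.1
      have h1 : √x < 1 := by rw [Real.sqrt_lt' one_pos]; simpa using hx.2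
      refine ⟨2 * Real.arcsin √x, ⟨?_, ?_⟩, ?_⟩
      · have := Real.arcsin_pos.2 h0; linarith
      · have := Real.arcsin_lt_pi_div_two.2 h1; linarith
      · simp only
        rw [mul_div_cancel_left₀ _ two_ne_zero, Real.sin_arcsin (by linarith) h1.le,
          Real.sq_sqrt hx.1.le]
  have hcv := MeasureTheory.integral_image_eq_integral_abs_deriv_smul measurableSet_Ioo hder hinj
    (fun x : ℝ => x ^ ((β + 1) / 2 - 1) * (1 - x) ^ ((1 / 2 : ℝ) - 1))
  rw [himg] at hcv
  have hB := integral_rpow_mul_one_sub_rpow (a := (β + 1) / 2) (b := 1 / 2) (by linarith)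
    (by norm_num)
  rw [intervalIntegral.integral_of_le zero_le_one, MeasureTheory.integral_Ioc_eq_integral_Ioo,
    hcv] at hB
  have hint : ∫ t in Set.Ioo (0 : ℝ) π, |Real.sin (t / 2) * Real.cos (t / 2)| •
      ((Real.sin (t / 2) ^ 2) ^ ((β + 1) / 2 - 1) *
        (1 - Real.sin (t / 2) ^ 2) ^ ((1 / 2 : ℝ) - 1)) =
      ∫ t in Set.Ioo (0 : ℝ) π, Real.sin (t / 2) ^ β := by
    refine MeasureTheory.setIntegral_congr_fun measurableSet_Ioo fun t ht => ?_
    have s := Real.sin_pos_of_pos_of_lt_pi (x := t / 2) (by linarith [ht.1]) (by linarith [ht.2])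
    have c := Real.cos_pos_of_mem_Ioo (x := t / 2) ⟨by linarith [ht.1], by linarith [ht.2]⟩
    have e1 : 1 - Real.sin (t / 2) ^ 2 = Real.cos (t / 2) ^ 2 := by
      rw [← Real.sin_sq_add_cos_sq (t / 2)]; ring
    rw [e1, abs_of_pos (mul_pos s c), ← Real.rpow_natCast, ← Real.rpow_natCast,
      ← Real.rpow_mul s.le, ← Real.rpow_mul c.le]
    have e2 : ((2 : ℕ) : ℝ) * ((β + 1) / 2 - 1) = β - 1 := by push_cast; ring
    have e3 : ((2 : ℕ) : ℝ) * ((1 / 2 : ℝ) - 1) = -1 := by norm_num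
    rw [e2, e3, Real.rpow_neg_one, Real.rpow_sub_one s.ne', smul_eq_mul]
    field_simp
  rw [hint] at hB
  rw [intervalIntegral.integral_of_le hpi.le, MeasureTheory.integral_Ioc_eq_integral_Ioo, hB,
    show (β + 1) / 2 + 1 / 2 = β / 2 + 1 by ring, Real.Gamma_one_half_eq]
  have hd := Real.Gamma_mul_Gamma_add_half ((β + 1) / 2)
  rw [show (β + 1) / 2 + 1 / 2 = β / 2 + 1 by ring, show 2 * ((β + 1) / 2) = β + 1 by ring,
    show 1 - (β + 1) = -β by ring, Real.rpow_neg (by norm_num)] at hd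
  have hG := Real.Gamma_pos_of_pos (show 0 < β / 2 + 1 by linarith)
  have h2 : (0 : ℝ) < 2 ^ β := by positivity
  have hd' : Real.Gamma ((β + 1) / 2) =
      Real.Gamma (β + 1) * (2 ^ β)⁻¹ * √π / Real.Gamma (β / 2 + 1) := by
    rw [← hd]; field_simp
  rw [hd']
  field_simp
  rw [Real.sq_sqrt hpi.le]

theorem integral_sin_half_rpow_mul_cos_succ {β : ℝ} (hβ : 0 < β) (k : ℝ)
    (hk : Real.cos ((k + 1 / 2) * π) = 0) :
    (k + 1 + β / 2) * ∫ t in (0 : ℝ)..π, Real.sin (t / 2) ^ β * Real.cos ((k + 1) * t) =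
      (k - β / 2) * ∫ t in (0 : ℝ)..π, Real.sin (t / 2) ^ β * Real.cos (k * t) := by
  have hcont : Continuous fun t : ℝ => Real.sin (t / 2) ^ β :=
    Continuous.rpow_const (by fun_prop) fun _ => Or.inr hβ.le
  have hftc := intervalIntegral.integral_eq_sub_of_hasDerivAt (a := 0) (b := π)
    (f := fun t : ℝ => Real.sin (t / 2) ^ (β + 1) * Real.cos ((k + 1 / 2) * t))
    (f' := fun t : ℝ => (1 / 2) * ((k + 1 + β / 2) * (Real.sin (t / 2) ^ β * Real.cos ((k + 1) * t))
      - (k - β / 2) * (Real.sin (t / 2) ^ β * Real.cos (k * t)))) ?_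
      (Continuous.intervalIntegrable (by fun_prop) _ _)
  · have hz : (0 : ℝ) ^ (β + 1) = 0 := Real.zero_rpow (by linarith)
    simp only [zero_div, Real.sin_zero, hz, zero_mul, sub_zero, hk, mul_zero] at hftc
    rw [intervalIntegral.integral_const_mul, intervalIntegral.integral_sub
      (Continuous.intervalIntegrable (by fun_prop) _ _)
      (Continuous.intervalIntegrable (by fun_prop) _ _), intervalIntegral.integral_const_mul,
      intervalIntegral.integral_const_mul] at hftc
    linarith
  · intro t ht
    rw [Set.uIcc_of_le Real.pi_pos.le] at ht
    have hs : 0 ≤ Real.sin (t / 2) :=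
      Real.sin_nonneg_of_nonneg_of_le_pi (by linarith [ht.1]) (by linarith [ht.2, Real.pi_pos])
    have d1 : HasDerivAt (fun t : ℝ => Real.sin (t / 2)) (Real.cos (t / 2) * (1 / 2)) t :=
      ((hasDerivAt_id t).div_const 2).sin
    have d2 := d1.rpow_const (p := β + 1) (Or.inr (by linarith))
    have d3 : HasDerivAt (fun t : ℝ => Real.cos ((k + 1 / 2) * t))
        (-Real.sin ((k + 1 / 2) * t) * ((k + 1 / 2) * 1)) t :=
      (Real.hasDerivAt_cos ((k + 1 / 2) * t)).comp t ((hasDerivAt_id t).const_mul (k + 1 / 2))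
    refine (d2.mul d3).congr_deriv ?_
    rw [add_sub_cancel_right, Real.rpow_add_one' hs (by linarith),
      show (k + 1) * t = (k + 1 / 2) * t + t / 2 by ring,
      show k * t = (k + 1 / 2) * t - t / 2 by ring, Real.cos_add, Real.cos_sub]
    ring

/-- The numbers `ĝ_k` are the Fourier coefficients of `|2 sin (t / 2)| ^ β`. -/
theorem integral_abs_two_sin_rpow_mul_cos {β : ℝ} (h1 : 0 < β) (h2 : β < 2) (k : ℤ) :
    ∫ t in (-π)..π, |2 * Real.sin (t / 2)| ^ β * Real.cos (k * t) = 2 * π * gHat β k := by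
  have hpi := Real.pi_pos
  have hcont : Continuous fun t : ℝ => |2 * Real.sin (t / 2)| ^ β :=
    Continuous.rpow_const (by fun_prop) fun _ => Or.inr h1.le
  have hnat : ∀ n : ℕ, 2 ^ β * ∫ t in (0 : ℝ)..π, Real.sin (t / 2) ^ β * Real.cos (n * t) =
      π * gHat β n := by
    intro n
    induction n with
    | zero => simpa [gHat_zero] using integral_sin_half_rpow h1
    | succ n ih =>
      have hc : Real.cos (((n : ℝ) + 1 / 2) * π) = 0 := by
        rw [Real.cos_eq_zero_iff]
        exact ⟨n, by push_cast; ring⟩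
      have h := integral_sin_half_rpow_mul_cos_succ h1 n hc
      have hg := gHat_succ h1 h2 n
      have hne : (n : ℝ) + 1 + β / 2 ≠ 0 := by positivity
      push_cast at hg ⊢
      apply mul_left_cancel₀ hne
      rw [mul_left_comm, h, mul_left_comm, ih, mul_left_comm, mul_left_comm _ π,
        mul_comm _ (gHat β (n + 1)), hg]
      ring
  have hhalf : ∀ n : ℕ, ∫ t in (0 : ℝ)..π, |2 * Real.sin (t / 2)| ^ β * Real.cos (n * t) =
      π * gHat β n := by
    intro n
    rw [← hnat, ← intervalIntegral.integral_const_mul]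
    refine intervalIntegral.integral_congr fun t ht => ?_
    rw [Set.uIcc_of_le hpi.le] at ht
    have hs : 0 ≤ Real.sin (t / 2) :=
      Real.sin_nonneg_of_nonneg_of_le_pi (by linarith [ht.1]) (by linarith [ht.2])
    rw [abs_of_nonneg (by positivity), Real.mul_rpow (by norm_num) hs, mul_assoc]
  have hfull : ∀ n : ℕ, ∫ t in (-π)..π, |2 * Real.sin (t / 2)| ^ β * Real.cos (n * t) =
      2 * π * gHat β n := by
    intro n
    rw [← intervalIntegral.integral_add_adjacent_intervals (b := 0)
      (Continuous.intervalIntegrable (by fun_prop) _ _)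
      (Continuous.intervalIntegrable (by fun_prop) _ _), hhalf]
    have := intervalIntegral.integral_comp_neg (a := 0) (b := π)
      (fun t : ℝ => |2 * Real.sin (t / 2)| ^ β * Real.cos (n * t))
    rw [neg_zero] at this
    rw [← this]
    simp only [neg_div, Real.sin_neg, mul_neg, abs_neg, Real.cos_neg]
    rw [hhalf]
    ring
  obtain ⟨n, rfl | rfl⟩ := Int.eq_nat_or_neg k
  · simpa using hfull n
  · rw [gHat_neg, ← hfull n]
    simp

theorem gHat_form_eq_integral {β : ℝ} (h1 : 0 < β) (h2 : β < 2) (m : ℕ) (v : ℕ → ℝ) :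
    2 * π * ∑ i ∈ Finset.range m, ∑ j ∈ Finset.range m,
        gHat β ((i : ℤ) - (j : ℤ)) * v i * v j =
      ∫ t in (-π)..π, |2 * Real.sin (t / 2)| ^ β *
        ((∑ p ∈ Finset.range m, v p * Real.cos (p * t)) ^ 2 +
          (∑ p ∈ Finset.range m, v p * Real.sin (p * t)) ^ 2) := by
  have hcont : Continuous fun t : ℝ => |2 * Real.sin (t / 2)| ^ β :=
    Continuous.rpow_const (by fun_prop) fun _ => Or.inr h1.le
  simp_rw [← normSq_trigPoly, Finset.mul_sum]
  rw [intervalIntegral.integral_finsetSum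
    (fun p _ => Continuous.intervalIntegrable (by fun_prop) _ _)]
  refine Finset.sum_congr rfl fun i _ => ?_
  rw [intervalIntegral.integral_finsetSum
    (fun p _ => Continuous.intervalIntegrable (by fun_prop) _ _)]
  refine Finset.sum_congr rfl fun j _ => ?_
  have h := integral_abs_two_sin_rpow_mul_cos h1 h2 ((i : ℤ) - j)
  push_cast at h
  rw [← mul_assoc, ← mul_assoc, ← h, mul_assoc, mul_comm, ← intervalIntegral.integral_const_mul]
  refine intervalIntegral.integral_congr fun t _ => ?_
  ring

theorem norm_sq_gridFourier (h : ℝ) (M : ℕ) (v : ℕ → ℝ) (ξ : ℝ) :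
    ‖gridFourier h M v ξ‖ ^ 2 = h ^ 2 / (2 * π) *
      ((∑ p ∈ Finset.range (M + 1), v p * Real.cos (p * (h * ξ))) ^ 2 +
          (∑ p ∈ Finset.range (M + 1), v p * Real.sin (p * (h * ξ))) ^ 2) := by
  unfold gridFourier
  rw [norm_mul, mul_pow, Complex.norm_real, Real.norm_eq_abs, sq_abs, mul_pow, div_pow, one_pow,
    Real.sq_sqrt (by positivity), ← Complex.normSq_eq_norm_sq, Complex.normSq_apply]
  have e : ∀ j : ℕ, (v j : ℂ) * Complex.exp (-(Complex.I * (ξ : ℂ) * (((j : ℝ) * h : ℝ) : ℂ))) =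
      ((v j * Real.cos (j * (h * ξ)) : ℝ) : ℂ) - ((v j * Real.sin (j * (h * ξ)) : ℝ) : ℂ) *
        Complex.I := by
    intro j
    have : -(Complex.I * (ξ : ℂ) * (((j : ℝ) * h : ℝ) : ℂ)) =
        ((-(j * (h * ξ)) : ℝ) : ℂ) * Complex.I := by push_cast; ring
    rw [this, Complex.exp_mul_I, ← Complex.ofReal_cos, ← Complex.ofReal_sin, Real.cos_neg,
      Real.sin_neg]
    push_cast
    ring
  simp only [e, Complex.re_sum, Complex.im_sum, Complex.sub_re, Complex.sub_im, Complex.mul_re,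
    Complex.mul_im, Complex.ofReal_re, Complex.ofReal_im, Complex.I_re, Complex.I_im]
  simp
  ring

/-- The energy of the fractional centered difference operator is at most the squared discrete
fractional Sobolev seminorm. -/
theorem gHat_form_le_sobolevSemiSq {β h : ℝ} (h1 : 0 < β) (h2 : β < 2) (hh : 0 < h) (M : ℕ)
    (v : ℕ → ℝ) :
    h ^ (-β) * (h * ∑ i ∈ Finset.range (M + 1), ∑ j ∈ Finset.range (M + 1),
        gHat β ((i : ℤ) - (j : ℤ)) * v i * v j) ≤ sobolevSemiSq (β / 2) h M v := by
  have hpi := Real.pi_pos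
  set V : ℝ → ℝ := fun t => (∑ p ∈ Finset.range (M + 1), v p * Real.cos (p * t)) ^ 2 +
          (∑ p ∈ Finset.range (M + 1), v p * Real.sin (p * t)) ^ 2 with hV
  have hVc : Continuous V := by simp only [hV]; fun_prop
  have hV0 : ∀ t, 0 ≤ V t := fun t => by simp only [hV]; positivity
  have hsob : sobolevSemiSq (β / 2) h M v =
      h ^ (-β) * (h / (2 * π)) * ∫ t in (-π)..π, |t| ^ β * V t := by
    unfold sobolevSemiSq
    have e : ∀ ξ : ℝ, |ξ| ^ (2 * (β / 2)) * ‖gridFourier h M v ξ‖ ^ 2 =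
        h ^ (-β) * (h ^ 2 / (2 * π)) * (|h * ξ| ^ β * V (h * ξ)) := by
      intro ξ
      have hn : ‖gridFourier h M v ξ‖ ^ 2 = h ^ 2 / (2 * π) * V (h * ξ) :=
        norm_sq_gridFourier h M v ξ
      rw [hn, mul_div_cancel₀ β two_ne_zero, abs_mul, abs_of_pos hh,
        Real.mul_rpow hh.le (abs_nonneg _), Real.rpow_neg hh.le]
      have : h ^ β ≠ 0 := (Real.rpow_pos_of_pos hh β).ne'
      generalize V (h * ξ) = y
      field_simp
    simp_rw [e]
    rw [intervalIntegral.integral_const_mul,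
      intervalIntegral.integral_comp_mul_left (f := fun t => |t| ^ β * V t) hh.ne']
    have e1 : h * -(π / h) = -π := by field_simp
    have e2 : h * (π / h) = π := by field_simp
    rw [e1, e2, smul_eq_mul]
    field_simp
  have hform := gHat_form_eq_integral h1 h2 (M + 1) v
  have hle : ∫ t in (-π)..π, |2 * Real.sin (t / 2)| ^ β * V t ≤
      ∫ t in (-π)..π, |t| ^ β * V t := by
    have c1 : Continuous fun t : ℝ => |2 * Real.sin (t / 2)| ^ β :=
      Continuous.rpow_const (by fun_prop) fun _ => Or.inr h1.le
    have c2 : Continuous fun t : ℝ => |t| ^ β :=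
      Continuous.rpow_const (by fun_prop) fun _ => Or.inr h1.le
    refine intervalIntegral.integral_mono_on (by linarith)
      (Continuous.intervalIntegrable (by fun_prop) _ _)
      (Continuous.intervalIntegrable (by fun_prop) _ _) fun t _ => ?_
    refine mul_le_mul_of_nonneg_right (Real.rpow_le_rpow (abs_nonneg _) ?_ h1.le) (hV0 t)
    have := Real.abs_sin_le_abs (x := t / 2)
    rw [abs_mul, abs_two]
    rw [abs_div, abs_two] at this
    linarith
  rw [hsob]
  rw [← hform] at hle
  have hc : 0 ≤ h ^ (-β) * (h / (2 * π)) := by positivity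
  have := mul_le_mul_of_nonneg_left hle hc
  refine le_trans (le_of_eq ?_) this
  field_simp

theorem normSq_nonneg {h : ℝ} (hh : 0 ≤ h) (M : ℕ) (v : ℕ → ℝ) : 0 ≤ normSq h M v :=
  mul_nonneg hh (Finset.sum_nonneg fun _ _ => sq_nonneg _)

theorem mul_inner_le_normSq {h : ℝ} (hh : 0 ≤ h) (M : ℕ) (c : ℝ) (a b : ℕ → ℝ) :
    c * (h * ∑ i ∈ Finset.Icc 1 (M - 1), a i * b i) ≤
      (c ^ 2 * normSq h M a + normSq h M b) / 2 := by
  have e : ∑ i ∈ Finset.Icc 1 (M - 1), c * (a i * b i) ≤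
      ∑ i ∈ Finset.Icc 1 (M - 1), (c ^ 2 * a i ^ 2 + b i ^ 2) / 2 :=
    Finset.sum_le_sum fun i _ => by nlinarith [sq_nonneg (c * a i - b i)]
  rw [← Finset.mul_sum, ← Finset.sum_div, Finset.sum_add_distrib, ← Finset.mul_sum] at e
  have := mul_le_mul_of_nonneg_left e hh
  unfold normSq
  linarith

theorem le_mul_one_add_pow_of_le_add_sum {a : ℕ → ℝ} {D τ : ℝ} (hτ : 0 ≤ τ) {S : ℕ}
    (h : ∀ s ≤ S, a s ≤ D + τ * ∑ n ∈ Finset.range s, a n) : a S ≤ D * (1 + τ) ^ S := by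
  have key : ∀ s ≤ S, D + τ * ∑ n ∈ Finset.range s, a n ≤ D * (1 + τ) ^ s := by
    intro s
    induction s with
    | zero => simp
    | succ s ih =>
      intro hs
      have h1 := h s (by omega)
      have h2 := ih (by omega)
      rw [Finset.sum_range_succ, pow_succ]
      have := mul_le_mul_of_nonneg_left h1 hτ
      have := mul_le_mul_of_nonneg_right h2 (show 0 ≤ 1 + τ by linarith)
      linarith
  exact (h S le_rfl).trans (key S le_rfl)

theorem sum_mul_sub_succ (g w : ℕ → ℝ) (s : ℕ) :
    ∑ n ∈ Finset.range (s + 1), g (n + 1) * (w (n + 1) - w n) =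
      g (s + 1) * w (s + 1) - g 1 * w 0 -
        ∑ n ∈ Finset.range s, (g (n + 1 + 1) - g (n + 1)) * w (n + 1) := by
  induction s with
  | zero => simp; ring
  | succ s ih => rw [Finset.sum_range_succ, ih, Finset.sum_range_succ _ s]; ring

theorem sum_range_eq_sum_interior {M : ℕ} (hM : 1 ≤ M) {f : ℕ → ℝ} (h0 : f 0 = 0) (h1 : f M = 0) :
    ∑ j ∈ Finset.range (M + 1), f j = ∑ j ∈ Finset.Icc 1 (M - 1), f j := by
  symm
  refine Finset.sum_subset (fun j hj => ?_) fun j hj hj' => ?_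
  · rw [Finset.mem_Icc] at hj; rw [Finset.mem_range]; omega
  · rw [Finset.mem_range] at hj
    rw [Finset.mem_Icc] at hj'
    have : j = 0 ∨ j = M := by omega
    rcases this with rfl | rfl <;> assumption

/-- The quadratic form of the fractional centered difference matrix on the interior nodes. -/
def gHatForm (β : ℝ) (M : ℕ) (v : ℕ → ℝ) : ℝ :=
  ∑ i ∈ Finset.Icc 1 (M - 1), ∑ j ∈ Finset.Icc 1 (M - 1), gHat β ((i : ℤ) - (j : ℤ)) * v i * v j

theorem sum_range_gHat_eq_gHatForm {M : ℕ} (hM : 1 ≤ M) (β : ℝ) {v : ℕ → ℝ} (h0 : v 0 = 0)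
    (h1 : v M = 0) :
    ∑ i ∈ Finset.range (M + 1), ∑ j ∈ Finset.range (M + 1),
      gHat β ((i : ℤ) - (j : ℤ)) * v i * v j = gHatForm β M v := by
  rw [sum_range_eq_sum_interior hM (by simp [h0]) (by simp [h1])]
  exact Finset.sum_congr rfl fun i _ =>
    sum_range_eq_sum_interior hM (by simp [h0]) (by simp [h1])

theorem sum_spaceSum_mul_halfDiff {M : ℕ} (hM : 1 ≤ M) (β τ : ℝ) (u : ℕ → ℕ → ℝ) (n : ℕ)
    (hn : u n 0 = 0 ∧ u n M = 0) (hn' : u (n - 1) 0 = 0 ∧ u (n - 1) M = 0) :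
    ∑ i ∈ Finset.Icc 1 (M - 1), spaceSum β M (halfAvg u n) i * halfDiff τ u n i =
      (gHatForm β M (u n) - gHatForm β M (u (n - 1))) / (2 * τ) := by
  have hsymm : ∑ i ∈ Finset.Icc 1 (M - 1), ∑ j ∈ Finset.Icc 1 (M - 1),
        gHat β ((i : ℤ) - (j : ℤ)) * u n i * u (n - 1) j =
      ∑ i ∈ Finset.Icc 1 (M - 1), ∑ j ∈ Finset.Icc 1 (M - 1),
        gHat β ((i : ℤ) - (j : ℤ)) * u (n - 1) i * u n j := by
    rw [Finset.sum_comm]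
    refine Finset.sum_congr rfl fun i _ => Finset.sum_congr rfl fun j _ => ?_
    rw [← gHat_neg, neg_sub]
    ring
  have hrow : ∀ i, spaceSum β M (halfAvg u n) i * halfDiff τ u n i =
      ((∑ j ∈ Finset.Icc 1 (M - 1), gHat β ((i : ℤ) - (j : ℤ)) * u n i * u n j)
        + (∑ j ∈ Finset.Icc 1 (M - 1), gHat β ((i : ℤ) - (j : ℤ)) * u n i * u (n - 1) j)
        - (∑ j ∈ Finset.Icc 1 (M - 1), gHat β ((i : ℤ) - (j : ℤ)) * u (n - 1) i * u n j)
        - (∑ j ∈ Finset.Icc 1 (M - 1), gHat β ((i : ℤ) - (j : ℤ)) * u (n - 1) i * u (n - 1) j))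
        / (2 * τ) := by
    intro i
    rw [spaceSum, sum_range_eq_sum_interior hM (by simp [halfAvg, hn.1, hn'.1])
      (by simp [halfAvg, hn.2, hn'.2]), ← Finset.sum_add_distrib, ← Finset.sum_sub_distrib,
      ← Finset.sum_sub_distrib, Finset.sum_div, Finset.sum_mul]
    refine Finset.sum_congr rfl fun j _ => ?_
    unfold halfAvg halfDiff
    by_cases hτ : τ = 0
    · simp [hτ]
    · field_simp
      ring
  simp only [hrow]
  rw [← Finset.sum_div]
  simp only [Finset.sum_sub_distrib, Finset.sum_add_distrib]
  rw [hsymm, gHatForm, gHatForm]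
  ring

theorem gammaNode_nonneg (J l : ℕ) : 0 ≤ gammaNode J l := by
  unfold gammaNode alphaNode dAlpha
  have : 0 ≤ (l : ℝ) * (1 / (2 * J)) := by positivity
  linarith

theorem gammaNode_le_one {J l : ℕ} (hl : l ≤ 2 * J) : gammaNode J l ≤ 1 := by
  unfold gammaNode alphaNode dAlpha
  have : (l : ℝ) ≤ 2 * J := by exact_mod_cast hl
  have : (l : ℝ) * (1 / (2 * J)) ≤ 1 := by
    rw [mul_one_div]
    exact div_le_one_of_le₀ this (by positivity)
  linarith

theorem sum_timeOp_mul_halfDiff_nonneg {ω : ℝ → ℝ} (hω : ∀ α ∈ Set.Icc (1 : ℝ) 2, 0 ≤ ω α)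
    (J : ℕ) {τ : ℝ} (hτ : 0 ≤ τ) (u : ℕ → ℕ → ℝ) (m i : ℕ) :
    0 ≤ ∑ n ∈ Finset.range m, timeOp ω J τ u (n + 1) i * halfDiff τ u (n + 1) i := by
  have e : ∑ n ∈ Finset.range m, timeOp ω J τ u (n + 1) i * halfDiff τ u (n + 1) i =
      dAlpha J * ∑ l ∈ Finset.range (2 * J + 1),
        trapWeight J l * ω (alphaNode J l) * (1 / τ ^ gammaNode J l) *
        ∑ n ∈ Finset.range m, (∑ k ∈ Finset.range (n + 1),
          lamCoef (gammaNode J l) k * halfDiff τ u (n - k + 1) i) * halfDiff τ u (n + 1) i := by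
    have e1 : ∀ n, timeOp ω J τ u (n + 1) i * halfDiff τ u (n + 1) i =
        dAlpha J * ∑ l ∈ Finset.range (2 * J + 1),
        trapWeight J l * ω (alphaNode J l) * (1 / τ ^ gammaNode J l) *
        ((∑ k ∈ Finset.range (n + 1),
          lamCoef (gammaNode J l) k * halfDiff τ u (n - k + 1) i) * halfDiff τ u (n + 1) i) := by
      intro n
      rw [timeOp, mul_assoc, Finset.sum_mul]
      congr 1
      refine Finset.sum_congr rfl fun l _ => ?_
      rw [mul_assoc]
      congr 2
      refine Finset.sum_congr rfl fun k hk => ?_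
      rw [Finset.mem_range] at hk
      rw [show n + 1 - k = n - k + 1 by omega]
    rw [Finset.sum_congr rfl fun n _ => e1 n, ← Finset.mul_sum, Finset.sum_comm]
    simp only [Finset.mul_sum]
  rw [e]
  refine mul_nonneg (by unfold dAlpha; positivity) (Finset.sum_nonneg fun l hl => ?_)
  rw [Finset.mem_range] at hl
  have h0 := gammaNode_nonneg J l
  have h1 := gammaNode_le_one (J := J) (l := l) (by omega)
  have hw : 0 ≤ trapWeight J l := by unfold trapWeight; split_ifs <;> norm_num
  have ho : 0 ≤ ω (alphaNode J l) := by
    refine hω _ ⟨?_, ?_⟩ <;> unfold gammaNode at h0 h1 <;> linarith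
  have ht : 0 ≤ 1 / τ ^ gammaNode J l := by positivity
  exact mul_nonneg (mul_nonneg (mul_nonneg hw ho) ht)
    (lamCoef_form_nonneg h0 h1 m fun p => halfDiff τ u (p + 1) i)

section Energy

variable {β K L T : ℝ} {ω : ℝ → ℝ} {M N J : ℕ} {G : ℕ → ℕ → ℝ} {φ : ℕ → ℝ} {u : ℕ → ℕ → ℝ}

theorem IsSchemeSolution.energy_le (hu : IsSchemeSolution β K L T ω M N J G φ u)
    (hω : ∀ α ∈ Set.Icc (1 : ℝ) 2, 0 ≤ ω α) (hM : 1 ≤ M) (hN : 1 ≤ N) (hT : 0 < T)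
    {m : ℕ} (hm : m ≤ N) :
    K * (L / M) ^ (-β) * (gHatForm β M (u m) - gHatForm β M (u 0)) ≤
      2 * ∑ i ∈ Finset.Icc 1 (M - 1), ∑ n ∈ Finset.range m,
        G (n + 1) i * (u (n + 1) i - u n i) := by
  have hτ : 0 < T / N := div_pos hT (by exact_mod_cast hN)
  set τ := T / N with hτd
  have hlevel : ∀ n ∈ Finset.range m,
      ∑ i ∈ Finset.Icc 1 (M - 1), timeOp ω J τ u (n + 1) i * halfDiff τ u (n + 1) i =
      -(K * (L / M) ^ (-β) * ((gHatForm β M (u (n + 1)) - gHatForm β M (u n)) / (2 * τ))) +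
        ∑ i ∈ Finset.Icc 1 (M - 1), G (n + 1) i * halfDiff τ u (n + 1) i := by
    intro n hn
    rw [Finset.mem_range] at hn
    have hs := sum_spaceSum_mul_halfDiff hM β τ u (n + 1) (hu.boundary _ (by omega))
      (hu.boundary _ (by omega))
    rw [Nat.add_sub_cancel] at hs
    rw [← hs, Finset.mul_sum, ← Finset.sum_neg_distrib, ← Finset.sum_add_distrib]
    refine Finset.sum_congr rfl fun i hi => ?_
    rw [Finset.mem_Icc] at hi
    rw [hu.scheme (n + 1) i (by omega) (by omega) hi.1 hi.2]
    ring
  have hpos : 0 ≤ ∑ n ∈ Finset.range m,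
      ∑ i ∈ Finset.Icc 1 (M - 1), timeOp ω J τ u (n + 1) i * halfDiff τ u (n + 1) i := by
    rw [Finset.sum_comm]
    exact Finset.sum_nonneg fun i _ => sum_timeOp_mul_halfDiff_nonneg hω J hτ.le u m i
  rw [Finset.sum_congr rfl hlevel, Finset.sum_add_distrib, Finset.sum_neg_distrib,
    ← Finset.mul_sum, ← Finset.sum_div, Finset.sum_range_sub fun n => gHatForm β M (u n),
    Finset.sum_comm] at hpos
  have e : ∑ i ∈ Finset.Icc 1 (M - 1), ∑ n ∈ Finset.range m, G (n + 1) i * halfDiff τ u (n + 1) i =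
      (∑ i ∈ Finset.Icc 1 (M - 1), ∑ n ∈ Finset.range m, G (n + 1) i * (u (n + 1) i - u n i))
        / τ := by
    simp only [Finset.sum_div]
    refine Finset.sum_congr rfl fun i _ => Finset.sum_congr rfl fun n _ => ?_
    rw [halfDiff, Nat.add_sub_cancel, mul_div_assoc]
  rw [e] at hpos
  have h2 := mul_nonneg (show 0 ≤ 2 * τ by positivity) hpos
  have h3 : 2 * τ * (-(K * (L / M) ^ (-β) *
      ((gHatForm β M (u m) - gHatForm β M (u 0)) / (2 * τ))) +
      (∑ i ∈ Finset.Icc 1 (M - 1), ∑ n ∈ Finset.range m, G (n + 1) i * (u (n + 1) i - u n i)) / τ) =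
      2 * (∑ i ∈ Finset.Icc 1 (M - 1), ∑ n ∈ Finset.range m, G (n + 1) i * (u (n + 1) i - u n i)) -
      K * (L / M) ^ (-β) * (gHatForm β M (u m) - gHatForm β M (u 0)) := by
    field_simp
    ring
  rw [h3] at h2
  linarith

theorem normSq_le_gHatForm (hβ₁ : 1 < β) (hβ₂ : β < 2) (hL : 0 < L) (hM : 1 ≤ M) (v : ℕ → ℝ) :
    normSq (L / M) M v ≤
      L ^ β / cStar β * ((L / M) ^ (-β) * (L / M * gHatForm β M v)) := by
  have hM0 : (0 : ℝ) < M := by exact_mod_cast hM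
  have hc := cStar_pos (by linarith : 0 < β) hβ₂
  have h := gHat_form_coercive hβ₁ hβ₂ M v
  have hLβ : 0 < L ^ β := Real.rpow_pos_of_pos hL β
  have hMβ : 0 < (M : ℝ) ^ β := Real.rpow_pos_of_pos hM0 β
  have h2 := mul_le_mul_of_nonneg_left h
    (show 0 ≤ L ^ β / cStar β * (L / M) ^ (-β) * (L / M) by positivity)
  change _ ≤ _ * gHatForm β M v at h2
  refine le_trans (le_of_eq ?_) (h2.trans_eq (by ring))
  rw [normSq, Real.rpow_neg (by positivity), Real.rpow_neg hM0.le, Real.div_rpow hL.le hM0.le]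
  field_simp

theorem gHatForm_le_sobolevSemiSq (hβ₁ : 1 < β) (hβ₂ : β < 2) (hL : 0 < L) (hM : 1 ≤ M)
    {v : ℕ → ℝ} (h0 : v 0 = 0) (h1 : v M = 0) :
    (L / M) ^ (-β) * (L / M * gHatForm β M v) ≤ sobolevSemiSq (β / 2) (L / M) M v := by
  have hM0 : (0 : ℝ) < M := by exact_mod_cast hM
  rw [← sum_range_gHat_eq_gHatForm hM β h0 h1]
  exact gHat_form_le_sobolevSemiSq (by linarith) hβ₂ (by positivity) M v

theorem IsSchemeSolution.normSq_succ_le (hu : IsSchemeSolution β K L T ω M N J G φ u)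
    (hβ₁ : 1 < β) (hβ₂ : β < 2) (hK : 0 < K) (hL : 0 < L) (hT : 0 < T)
    (hω : ∀ α ∈ Set.Icc (1 : ℝ) 2, 0 ≤ ω α) (hM : 1 ≤ M) (hN : 1 ≤ N)
    {s : ℕ} (hs : s + 1 ≤ N) :
    normSq (L / M) M (u (s + 1)) ≤
      3 * L ^ β / cStar β * sobolevSemiSq (β / 2) (L / M) M (u 0)
        + (2 * L ^ β / (K * cStar β)) ^ 2 *
          (normSq (L / M) M (G 1) + normSq (L / M) M (G (s + 1)))
        + (2 * L ^ β / (K * cStar β)) ^ 2 * (T / N * ∑ n ∈ Finset.range s,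
            normSq (L / M) M (halfDiff (T / N) G (n + 1 + 1)))
        + T / N * ∑ n ∈ Finset.range s, normSq (L / M) M (u (n + 1)) := by
  have hM0 : (0 : ℝ) < M := by exact_mod_cast hM
  have hτ : 0 < T / N := div_pos hT (by exact_mod_cast hN)
  have hc := cStar_pos (by linarith : 0 < β) hβ₂
  have hLβ : 0 < L ^ β := Real.rpow_pos_of_pos hL β
  have hE := hu.energy_le hω hM hN hT hs
  have hco := normSq_le_gHatForm hβ₁ hβ₂ hL hM (u (s + 1))
  have hco0 := normSq_le_gHatForm hβ₁ hβ₂ hL hM (u 0)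
  obtain ⟨b0, bM⟩ := hu.boundary 0 (by omega)
  have hsob := gHatForm_le_sobolevSemiSq hβ₁ hβ₂ hL hM b0 bM
  have hh : 0 < L / M := by positivity
  set h := L / M with hhd
  set τ := T / N with hτd
  set A := 2 * L ^ β / (K * cStar β) with hA
  set S := sobolevSemiSq (β / 2) h M (u 0) with hS
  have hsob' := mul_le_mul_of_nonneg_left hsob (show 0 ≤ L ^ β / cStar β by positivity)
  have habel : ∑ i ∈ Finset.Icc 1 (M - 1), ∑ n ∈ Finset.range (s + 1),
      G (n + 1) i * (u (n + 1) i - u n i) =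
      (∑ i ∈ Finset.Icc 1 (M - 1), G (s + 1) i * u (s + 1) i)
        - (∑ i ∈ Finset.Icc 1 (M - 1), G 1 i * u 0 i)
        - τ * ∑ n ∈ Finset.range s, ∑ i ∈ Finset.Icc 1 (M - 1),
          halfDiff τ G (n + 1 + 1) i * u (n + 1) i := by
    rw [Finset.sum_comm (s := Finset.range s), ← Finset.sum_sub_distrib, Finset.mul_sum,
      ← Finset.sum_sub_distrib]
    refine Finset.sum_congr rfl fun i _ => ?_
    rw [sum_mul_sub_succ (fun n => G n i) (fun n => u n i), Finset.mul_sum]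
    congr 1
    refine Finset.sum_congr rfl fun n _ => ?_
    rw [halfDiff, Nat.add_sub_cancel]
    field_simp
  rw [habel] at hE
  have hE2 := mul_le_mul_of_nonneg_left hE
    (show 0 ≤ L ^ β / (K * cStar β) * h by positivity)
  have y1 := mul_inner_le_normSq hh.le M A (G (s + 1)) (u (s + 1))
  have y2 := mul_inner_le_normSq hh.le M (-A) (G 1) (u 0)
  have y3 : τ * ∑ n ∈ Finset.range s, (-A) * (h * ∑ i ∈ Finset.Icc 1 (M - 1),
        halfDiff τ G (n + 1 + 1) i * u (n + 1) i) ≤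
      τ * ∑ n ∈ Finset.range s, ((-A) ^ 2 * normSq h M (halfDiff τ G (n + 1 + 1))
        + normSq h M (u (n + 1))) / 2 :=
    mul_le_mul_of_nonneg_left (Finset.sum_le_sum fun n _ => mul_inner_le_normSq hh.le M (-A) _ _)
      hτ.le
  rw [← Finset.mul_sum, ← Finset.mul_sum, ← Finset.sum_div, Finset.sum_add_distrib,
    ← Finset.mul_sum] at y3
  have el : L ^ β / (K * cStar β) * h *
      (K * h ^ (-β) * (gHatForm β M (u (s + 1)) - gHatForm β M (u 0))) =
      L ^ β / cStar β * (h ^ (-β) * (h * gHatForm β M (u (s + 1)))) -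
      L ^ β / cStar β * (h ^ (-β) * (h * gHatForm β M (u 0))) := by
    field_simp
  have er : ∀ x : ℝ, L ^ β / (K * cStar β) * h * (2 * x) = A * (h * x) := by
    intro x
    rw [hA]
    ring
  rw [el, er] at hE2
  have e3 : 3 * L ^ β / cStar β * S = 3 * (L ^ β / cStar β * S) := by ring
  rw [e3]
  nlinarith

theorem IsSchemeSolution.normSq_le (hu : IsSchemeSolution β K L T ω M N J G φ u)
    (hβ₁ : 1 < β) (hβ₂ : β < 2) (hK : 0 < K) (hL : 0 < L) (hT : 0 < T)
    (hω : ∀ α ∈ Set.Icc (1 : ℝ) 2, 0 ≤ ω α) (hM : 1 ≤ M) (hN : 1 ≤ N)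
    {s : ℕ} (hs : s + 1 ≤ N) {g : ℝ} (hg : ∀ n ≤ s, normSq (L / M) M (G (n + 1)) ≤ g) :
    normSq (L / M) M (u (s + 1)) ≤ Real.exp T *
      (3 * L ^ β / cStar β * sobolevSemiSq (β / 2) (L / M) M (u 0)
        + (2 * L ^ β / (K * cStar β)) ^ 2 * (normSq (L / M) M (G 1) + g)
        + (2 * L ^ β / (K * cStar β)) ^ 2 * (T / N * ∑ n ∈ Finset.range s,
            normSq (L / M) M (halfDiff (T / N) G (n + 1 + 1)))) := by
  have hM0 : (0 : ℝ) < M := by exact_mod_cast hM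
  have hN0 : (0 : ℝ) < N := by exact_mod_cast hN
  have hh : 0 < L / M := by positivity
  have hτ : 0 < T / N := by positivity
  have hc := cStar_pos (by linarith : 0 < β) hβ₂
  have hLβ : 0 < L ^ β := Real.rpow_pos_of_pos hL β
  obtain ⟨b0, bM⟩ := hu.boundary 0 (by omega)
  have hS : 0 ≤ L ^ β / cStar β * sobolevSemiSq (β / 2) (L / M) M (u 0) :=
    (normSq_nonneg hh.le M (u 0)).trans ((normSq_le_gHatForm hβ₁ hβ₂ hL hM (u 0)).trans
      (mul_le_mul_of_nonneg_left (gHatForm_le_sobolevSemiSq hβ₁ hβ₂ hL hM b0 bM) (by positivity)))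
  have hg0 : 0 ≤ g := (normSq_nonneg hh.le M _).trans (hg 0 (by omega))
  set D := 3 * L ^ β / cStar β * sobolevSemiSq (β / 2) (L / M) M (u 0)
        + (2 * L ^ β / (K * cStar β)) ^ 2 * (normSq (L / M) M (G 1) + g)
        + (2 * L ^ β / (K * cStar β)) ^ 2 * (T / N * ∑ n ∈ Finset.range s,
            normSq (L / M) M (halfDiff (T / N) G (n + 1 + 1))) with hD
  have hD0 : 0 ≤ D := by
    have h1 : 0 ≤ 3 * L ^ β / cStar β * sobolevSemiSq (β / 2) (L / M) M (u 0) := by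
      have : 3 * L ^ β / cStar β * sobolevSemiSq (β / 2) (L / M) M (u 0) =
        3 * (L ^ β / cStar β * sobolevSemiSq (β / 2) (L / M) M (u 0)) := by ring
      rw [this]; positivity
    have h2 := normSq_nonneg hh.le M (G 1)
    have h3 : 0 ≤ ∑ n ∈ Finset.range s, normSq (L / M) M (halfDiff (T / N) G (n + 1 + 1)) :=
      Finset.sum_nonneg fun n _ => normSq_nonneg hh.le M _
    positivity
  have hgron := le_mul_one_add_pow_of_le_add_sum (a := fun n => normSq (L / M) M (u (n + 1)))
    (D := D) hτ.le (S := s) ?_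
  · refine hgron.trans ?_
    rw [mul_comm]
    refine mul_le_mul_of_nonneg_right ?_ hD0
    calc (1 + T / N) ^ s ≤ Real.exp (T / N) ^ s :=
          pow_le_pow_left₀ (by positivity) (by linarith [Real.add_one_le_exp (T / N)]) s
      _ = Real.exp (s * (T / N)) := (Real.exp_nat_mul _ _).symm
      _ ≤ Real.exp T := by
        rw [Real.exp_le_exp]
        have : (s : ℝ) ≤ N := by exact_mod_cast (by omega : s ≤ N)
        calc s * (T / N) ≤ N * (T / N) := mul_le_mul_of_nonneg_right this hτ.le
          _ = T := by field_simp
  · intro r hr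
    refine (hu.normSq_succ_le hβ₁ hβ₂ hK hL hT hω hM hN (s := r) (by omega)).trans ?_
    rw [hD]
    gcongr
    · exact hg r hr
    · exact fun n _ _ => normSq_nonneg hh.le M _

end Energy

end FracWave

end

theorem theorem3p2 (β K L T : ℝ) (hβ₁ : 1 < β) (hβ₂ : β < 2) (hK : 0 < K) (hL : 0 < L)
    (hT : 0 < T) (ω : ℝ → ℝ) (hω : ∀ α ∈ Set.Icc (1 : ℝ) 2, 0 ≤ ω α)
    (M N J : ℕ) (hM : 1 ≤ M) (hN : 1 ≤ N) (hJ : 1 ≤ J)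
    (G : ℕ → ℕ → ℝ) (φ : ℕ → ℝ) (u : ℕ → ℕ → ℝ)
    (hu : FracWave.IsSchemeSolution β K L T ω M N J G φ u)
    (m : ℕ) (hm₁ : 1 ≤ m) (hm₂ : m ≤ N) :
    FracWave.normSq (L / M) M (u m) ≤
      Real.exp T *
        (3 * L ^ β / FracWave.cStar β * FracWave.sobolevSemiSq (β / 2) (L / M) M (u 0)
          + (2 * L ^ β / (K * FracWave.cStar β)) ^ 2 *
              (FracWave.normSq (L / M) M (G 1)
                + (Finset.Icc 1 m).sup' (Finset.nonempty_Icc.mpr hm₁)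
                    (fun n => FracWave.normSq (L / M) M (G n)))
          + (2 * L ^ β / (K * FracWave.cStar β)) ^ 2 *
              ((T / N) * ∑ n ∈ Finset.Icc 1 (m - 1),
                FracWave.normSq (L / M) M (FracWave.halfDiff (T / N) G (n + 1)))) := by
  obtain ⟨s, rfl⟩ : ∃ s, m = s + 1 := ⟨m - 1, by omega⟩
  have e : ∑ n ∈ Finset.Icc 1 (s + 1 - 1),
      FracWave.normSq (L / M) M (FracWave.halfDiff (T / N) G (n + 1)) =
      ∑ n ∈ Finset.range s, FracWave.normSq (L / M) M (FracWave.halfDiff (T / N) G (n + 1 + 1)) := by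
    rw [Nat.add_sub_cancel, Finset.range_eq_Ico, Finset.sum_Ico_add'
      (fun n => FracWave.normSq (L / M) M (FracWave.halfDiff (T / N) G (n + 1)))]
    rfl
  rw [e]
  refine hu.normSq_le hβ₁ hβ₂ hK hL hT hω hM hN hm₂ fun n hn => ?_
  exact Finset.le_sup' (fun n => FracWave.normSq (L / M) M (G n))
    (Finset.mem_Icc.2 ⟨by omega, by omega⟩)
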